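/- All rings and monoids are commutative with identity. Let $G$ be a finitely generated free abelian group (written additively) and $G^\star=\operatorname{Hom}(G,\mathbb Z)$. A convex cone in $G$ is a finitely generated saturated submonoid $M\subseteq G$ with $M\cap(-M)=\{0\}$ such that $G/M^{\mathrm{gp}}$ is torsion free, where $M^{\mathrm{gp}}$ is the subgroup generated by $M$ and saturated means that $x\in M^{\mathrm{gp}}$, $n\ge 1$, $nx\in M$ imply $x\in M$. A prime ideal of a monoid $P$ is a subset $\mathfrak p\subseteq P$ with $P+\mathfrak p\subseteq\mathfrak p$ whose complement $P-\mathfrak p$ is a submonoid. A fan in $G$ is a nonempty (possibly infinite) collection $\triangle$ of convex cones in $G$ such that (1) $P-\mathfrak p\in\triangle$ for all $P\in\triangle$ and all prime ideals $\mathfrak p$ of $P$; (2) for all $P,Q\in\triangle$ there are prime ideals $\mathfrak p$ of $P$ and $\mathfrak q$ of $Q$ with $P\cap Q=P-\mathfrak p=Q-\mathfrak q$. Let $R$ be a ring. For $P\in\triangle$ put $\check P=\{\sigma\in G^\star : \sigma(x)\ge 0 \text{ for all } x\in P\}$ and $\mathrm U_P=\operatorname{Spec}R[\check P]$. For $P\subseteq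 Q$ in $\triangle$ the inclusion $\check Q\subseteq\check P$ induces an open immersion $\mathrm U_P\to\mathrm U_Q$, and the toric scheme $X_R(\triangle)$ is obtained by gluing the $\mathrm U_P$, $P\in\triangle$, along $\mathrm U_P\cap\mathrm U_Q=\mathrm U_{P\cap Q}$; each $\mathrm U_P$ is regarded as an open subscheme of it. Let $\triangle$ and $\triangle'$ be fans in finitely generated free abelian groups $G$ and $G'$. A homomorphism of fans $\varphi\colon(G,\triangle)\to(G',\triangle')$ is a group homomorphism $\varphi\colon G\to G'$ such that for each $P\in\triangle$ there is a $P'\in\triangle'$ with $\varphi(P)\subseteq P'$. It induces a morphism $\varphi_*\colon X_R(\triangle)\to X_R(\triangle')$, which on $\mathrm U_P$ is the morphism $\mathrm U_P\to\mathrm U_{P'}$ given by $\check{P'}\to\check P$, $\sigma\mapsto\sigma\circ\varphi$, for any $P'\in\triangle'$ with $\varphi(P)\subseteq P'$. **Theorem.** Let $\varphi\colon(G,\triangle)\to(G',\triangle')$ be a homomorphism of fans. Then for any $P'\in\triangle'$, $$\varphi_*^{-1}(\mathrm U_{P'})=\bigcup_{\substack{P\in\triangle\\ \varphi(P)\subseteq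 P'}}\mathrm U_P$$ as open subsets of $X_R(\triangle)$. -/

import Mathlib

open CategoryTheory CategoryTheory.Limits AlgebraicGeometry

universe u v

namespace ToricFan

/-! ### Monoids and cones -/

/-- A prime ideal of an additive commutative monoid `M`: a subset `I` with `M + I ⊆ I` whose
complement is a submonoid. -/
structure IsPrimeIdeal {M : Type v} [AddCommMonoid M] (I : Set M) : Prop where
  add_mem : ∀ x y : M, y ∈ I → x + y ∈ I
  zero_notMem : (0 : M) ∉ I
  add_notMem : ∀ x y : M, x ∉ I → y ∉ I → x + y ∉ I

/-- The complement of a prime ideal of `M`, as a submonoid of `M`. -/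
def IsPrimeIdeal.compl {M : Type v} [AddCommMonoid M] {I : Set M} (hI : IsPrimeIdeal I) :
    AddSubmonoid M where
  carrier := Iᶜ
  zero_mem' := hI.zero_notMem
  add_mem' := fun {x y} hx hy => hI.add_notMem x y hx hy

/-- For a submonoid `P` of a group `G` and a prime ideal `p` of `P`, the submonoid `P - p` of `G`. -/
def faceOf {G : Type v} [AddCommGroup G] (P : AddSubmonoid G) {p : Set P}
    (hp : IsPrimeIdeal p) : AddSubmonoid G :=
  hp.compl.map P.subtype

/-- Convex cones in a finitely generated free abelian group `G`: finitely generated saturated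
submonoids `M` with no nonzero units such that `G / Mᵍᵖ` is torsion free. Here `Mᵍᵖ` is the
subgroup of `G` generated by `M`. -/
structure IsConvexCone {G : Type v} [AddCommGroup G] (M : AddSubmonoid G) : Prop where
  fg : M.FG
  saturated : ∀ x ∈ AddSubgroup.closure (M : Set G), ∀ n : ℕ, 0 < n → n • x ∈ M → x ∈ M
  pointed : ∀ x ∈ M, -x ∈ M → x = 0
  torsionFree : IsAddTorsionFree (G ⧸ AddSubgroup.closure (M : Set G))

/-- The dual `{σ ∈ Hom(G, ℤ) | σ(x) ≥ 0 for all x ∈ M}` of a submonoid `M` of `G`. -/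
def dualCone {G : Type v} [AddCommGroup G] (M : AddSubmonoid G) : AddSubmonoid (G →+ ℤ) where
  carrier := {σ | ∀ x ∈ M, 0 ≤ σ x}
  zero_mem' := fun _ _ => le_rfl
  add_mem' := fun hσ hτ x hx => add_nonneg (hσ x hx) (hτ x hx)

/-! ### Fans -/

/-- A fan in `G`: a nonempty (possibly infinite) collection of convex cones in `G`, closed under
passing to complements of prime ideals, in which the intersection of any two members is the
complement of a prime ideal in each of them. -/
structure Fan (G : Type v) [AddCommGroup G] where
  cones : Set (AddSubmonoid G)
  nonempty : cones.Nonempty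
  convex : ∀ P ∈ cones, IsConvexCone P
  face_mem : ∀ P ∈ cones, ∀ (p : Set P) (hp : IsPrimeIdeal p), faceOf P hp ∈ cones
  inter : ∀ P ∈ cones, ∀ Q ∈ cones, ∃ (p : Set P) (hp : IsPrimeIdeal p) (q : Set Q)
    (hq : IsPrimeIdeal q), P ⊓ Q = faceOf P hp ∧ P ⊓ Q = faceOf Q hq

/-- A homomorphism of fans: a group homomorphism which maps every cone of the source into
some cone of the target. -/
structure FanHom {G G' : Type v} [AddCommGroup G] [AddCommGroup G'] (Δ : Fan G) (Δ' : Fan G')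
    extends G →+ G' where
  exists_map_le : ∀ P ∈ Δ.cones, ∃ P' ∈ Δ'.cones, P.map toAddMonoidHom ≤ P'

/-! ### Exposing faces by linear functionals -/

theorem farkas {G : Type v} [AddCommGroup G] [Module.Free ℤ G] (n : ℕ) :
    ∀ (L : List G) (_ : L.length = n) (c : G),
      (∃ m : ℕ, 0 < m ∧ m • c ∈ AddSubmonoid.closure {x | x ∈ L}) ∨
        ∃ w : G →+ ℤ, (∀ a ∈ L, 0 ≤ w a) ∧ w c < 0 := by
  induction n with
  | zero =>
    intro L hL c
    obtain rfl := List.length_eq_zero_iff.mp hL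
    by_cases hc : c = 0
    · exact Or.inl ⟨1, one_pos, by simp [hc]⟩
    · right
      obtain ⟨f, hf⟩ : ∃ f : Module.Dual ℤ G, f c ≠ 0 := by
        by_contra! h
        exact hc ((Module.forall_dual_apply_eq_zero_iff ℤ c).mp h)
      rcases lt_or_gt_of_ne hf with h | h
      · exact ⟨f.toAddMonoidHom, by simp, h⟩
      · exact ⟨(-f).toAddMonoidHom, by simp, by simpa using h⟩
  | succ n ih =>
    intro L hL c
    obtain ⟨a, L, rfl⟩ : ∃ a L', L = a :: L' := by
      cases L with
      | nil => simp at hL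
      | cons a L => exact ⟨a, L, rfl⟩
    have hL' : L.length = n := by simpa using hL
    rcases ih L hL' c with ⟨m, hm, h⟩ | ⟨w, hw, hwc⟩
    · exact Or.inl ⟨m, hm, AddSubmonoid.closure_mono (fun x hx => List.mem_cons_of_mem _ hx) h⟩
    by_cases haw : 0 ≤ w a
    · refine Or.inr ⟨w, ?_, hwc⟩
      simpa [haw] using hw
    push Not at haw
    rcases ih (L.map fun b => (-w a) • b + (w b) • a) (by simpa using hL')
      ((-w a) • c + (w c) • a) with ⟨m, hm, h⟩ | ⟨w', hw', hwc'⟩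
    · left
      have key : ∀ y ∈ AddSubmonoid.closure
          {x | x ∈ L.map fun b => (-w a) • b + (w b) • a},
          ∀ k : ℕ, y + k • a ∈ AddSubmonoid.closure {x | x ∈ a :: L} := by
        intro y hy
        induction hy using AddSubmonoid.closure_induction with
        | mem x hx =>
          intro k
          obtain ⟨b, hb, rfl⟩ := List.mem_map.mp hx
          obtain ⟨t, ht⟩ := Int.eq_ofNat_of_zero_le (show 0 ≤ -w a by omega)
          obtain ⟨s, hs⟩ := Int.eq_ofNat_of_zero_le (hw b hb)
          simp only [ht, hs, natCast_zsmul]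
          have hb' : b ∈ AddSubmonoid.closure {x | x ∈ a :: L} :=
            AddSubmonoid.subset_closure (List.mem_cons_of_mem _ hb)
          have ha' : a ∈ AddSubmonoid.closure {x | x ∈ a :: L} :=
            AddSubmonoid.subset_closure List.mem_cons_self
          exact add_mem (add_mem (nsmul_mem hb' _) (nsmul_mem ha' _)) (nsmul_mem ha' _)
        | zero =>
          intro k
          have ha' : a ∈ AddSubmonoid.closure {x | x ∈ a :: L} :=
            AddSubmonoid.subset_closure List.mem_cons_self
          rw [zero_add]
          exact nsmul_mem ha' _
        | add x y _ _ hx hy =>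
          intro k
          have hxy := add_mem (hx k) (hy 0)
          rw [zero_smul, add_zero, add_right_comm] at hxy
          exact hxy
      have := key _ h (m * (w c).natAbs)
      refine ⟨m * (w a).natAbs, Nat.mul_pos hm (by omega), ?_⟩
      convert this using 1
      have h1 : ((w a).natAbs : ℤ) = -w a := by omega
      have h2 : ((w c).natAbs : ℤ) = -w c := by omega
      simp only [← natCast_zsmul, Nat.cast_mul, h1, h2]
      module
    · right
      refine ⟨(-w a) • w' + (w' a) • w, ?_, ?_⟩
      · intro b hb
        rcases List.mem_cons.mp hb with rfl | hb
        · simp [mul_comm]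
        · have := hw' _ (List.mem_map_of_mem hb)
          simp only [map_add, map_zsmul, smul_eq_mul, AddMonoidHom.add_apply,
            AddMonoidHom.smul_apply] at this ⊢
          linarith
      · simp only [map_add, map_zsmul, smul_eq_mul, AddMonoidHom.add_apply,
          AddMonoidHom.smul_apply] at hwc' ⊢
        linarith

theorem Fan.mem_of_add_mem {G : Type v} [AddCommGroup G] (Δ : Fan G) {P Q : AddSubmonoid G}
    (hP : P ∈ Δ.cones) (hQ : Q ∈ Δ.cones) (h : P ≤ Q) {x y : G} (hx : x ∈ Q) (hy : y ∈ Q)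
    (hxy : x + y ∈ P) : x ∈ P := by
  obtain ⟨p, hp, q, hq, -, e⟩ := Δ.inter P hP Q hQ
  rw [inf_eq_left.mpr h] at e
  rw [e] at hxy ⊢
  obtain ⟨z, hz, hz'⟩ := hxy
  refine ⟨⟨x, hx⟩, fun hxq => hz ?_, rfl⟩
  have : z = ⟨y, hy⟩ + ⟨x, hx⟩ := Subtype.ext (by simpa [add_comm] using hz')
  rw [this]
  exact hq.add_mem _ _ hxq

theorem Fan.inf_mem {G : Type v} [AddCommGroup G] (Δ : Fan G) {P Q : AddSubmonoid G}
    (hP : P ∈ Δ.cones) (hQ : Q ∈ Δ.cones) : P ⊓ Q ∈ Δ.cones := by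
  obtain ⟨p, hp, q, hq, e, -⟩ := Δ.inter P hP Q hQ
  exact e ▸ Δ.face_mem P hP p hp

theorem Fan.exists_expose {G : Type v} [AddCommGroup G] [Module.Free ℤ G] (Δ : Fan G)
    {P Q : AddSubmonoid G} (hP : P ∈ Δ.cones) (hQ : Q ∈ Δ.cones) (h : P ≤ Q) :
    ∃ w ∈ dualCone Q, (∀ x ∈ P, w x = 0) ∧ ∀ x ∈ Q, x ∉ P → 0 < w x := by
  classical
  obtain ⟨S, hS⟩ := (Δ.convex P hP).fg
  obtain ⟨T, hT⟩ := (Δ.convex Q hQ).fg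
  have key : ∀ x ∈ Q, x ∉ P → ∃ w ∈ dualCone Q, (∀ x ∈ P, w x = 0) ∧ 0 < w x := by
    intro x hxQ hxP
    rcases farkas _ (T.toList ++ S.toList.map Neg.neg) rfl (-x) with ⟨m, hm, hmem⟩ | ⟨w, hw, hwx⟩
    · exfalso
      have : ∀ y ∈ AddSubmonoid.closure {x | x ∈ T.toList ++ S.toList.map Neg.neg},
          ∃ p ∈ P, y + p ∈ Q := by
        intro y hy
        induction hy using AddSubmonoid.closure_induction with
        | mem y hy =>
          rcases List.mem_append.mp hy with hy | hy
          · refine ⟨0, zero_mem _, ?_⟩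
            rw [add_zero, ← hT]
            exact AddSubmonoid.subset_closure (Finset.mem_toList.mp hy)
          · obtain ⟨s, hs, rfl⟩ := List.mem_map.mp hy
            refine ⟨s, ?_, by simp⟩
            rw [← hS]
            exact AddSubmonoid.subset_closure (Finset.mem_toList.mp hs)
        | zero => exact ⟨0, zero_mem _, by simp⟩
        | add y z _ _ hy hz =>
          obtain ⟨p, hp, hp'⟩ := hy
          obtain ⟨q, hq, hq'⟩ := hz
          exact ⟨p + q, add_mem hp hq, by simpa [add_assoc, add_left_comm] using add_mem hp' hq'⟩
      obtain ⟨p, hp, hq⟩ := this _ hmem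
      obtain ⟨k, rfl⟩ : ∃ k, m = k + 1 := ⟨m - 1, by omega⟩
      refine hxP (Δ.mem_of_add_mem hP hQ h hxQ (add_mem (nsmul_mem hxQ k) hq) ?_)
      convert hp using 1
      simp only [← natCast_zsmul, Nat.cast_add, Nat.cast_one]
      module
    · have hwQ : w ∈ dualCone Q := by
        intro y hy
        rw [← hT] at hy
        induction hy using AddSubmonoid.closure_induction with
        | mem y hy => exact hw y (List.mem_append_left _ (Finset.mem_toList.mpr hy))
        | zero => simp
        | add y z _ _ hy hz => rw [map_add]; exact add_nonneg hy hz
      refine ⟨w, hwQ, ?_, by simpa using hwx⟩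
      intro y hy
      refine le_antisymm ?_ (hwQ y (h hy))
      rw [← hS] at hy
      induction hy using AddSubmonoid.closure_induction with
      | mem y hy =>
        have := hw (-y) (List.mem_append_right _ (List.mem_map_of_mem (Finset.mem_toList.mpr hy)))
        simpa using this
      | zero => simp
      | add y z _ _ hy hz => rw [map_add]; exact add_nonpos hy hz
  have key' : ∀ x : G, ∃ w ∈ dualCone Q, (∀ x ∈ P, w x = 0) ∧ (x ∈ Q → x ∉ P → 0 < w x) := by
    intro x
    by_cases hx : x ∈ Q ∧ x ∉ P
    · obtain ⟨w, h1, h2, h3⟩ := key x hx.1 hx.2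
      exact ⟨w, h1, h2, fun _ _ => h3⟩
    · exact ⟨0, zero_mem _, fun _ _ => rfl, fun h1 h2 => absurd ⟨h1, h2⟩ hx⟩
  choose w hwQ hwP hwx using key'
  refine ⟨∑ t ∈ T, w t, sum_mem fun t _ => hwQ t, fun x hx => ?_, fun x hx hxP => ?_⟩
  · simp only [AddMonoidHom.finsetSum_apply]
    exact Finset.sum_eq_zero fun t _ => hwP t x hx
  · have hpos : ∑ t ∈ T, w t ∈ dualCone Q := sum_mem fun t _ => hwQ t
    have : x ∈ Q ∧ (x ∈ P ∨ 0 < (∑ t ∈ T, w t) x) := by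
      rw [← hT] at hx
      clear hxP
      induction hx using AddSubmonoid.closure_induction with
      | mem t ht =>
        have htQ : t ∈ Q := hT ▸ AddSubmonoid.subset_closure ht
        refine ⟨htQ, ?_⟩
        by_cases htP : t ∈ P
        · exact Or.inl htP
        · right
          simp only [AddMonoidHom.finsetSum_apply]
          exact Finset.sum_pos' (fun s _ => hwQ s t htQ) ⟨t, ht, hwx t htQ htP⟩
      | zero => exact ⟨zero_mem _, Or.inl (zero_mem _)⟩
      | add y z _ _ hy hz =>
        refine ⟨add_mem hy.1 hz.1, ?_⟩
        rcases hy with ⟨hyQ, hy⟩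
        rcases hz with ⟨hzQ, hz⟩
        have hy0 := hpos y hyQ
        have hz0 := hpos z hzQ
        rw [map_add]
        rcases hy with hy | hy
        · rcases hz with hz | hz
          · exact Or.inl (add_mem hy hz)
          · right; linarith
        · right; linarith
    exact this.2.resolve_left hxP

/-! ### The affine charts -/

/-- The pullback `σ ↦ σ ∘ φ` from the dual of `P'` to the dual of `P`, when `φ(P) ⊆ P'`. -/
def dualMap {G G' : Type v} [AddCommGroup G] [AddCommGroup G'] (φ : G →+ G')
    {P : AddSubmonoid G} {P' : AddSubmonoid G'} (h : P.map φ ≤ P') :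
    dualCone P' →+ dualCone P where
  toFun σ := ⟨σ.1.comp φ, fun x hx => σ.2 (φ x) (h ⟨x, hx, rfl⟩)⟩
  map_zero' := rfl
  map_add' _ _ := rfl

/-- The affine scheme `U_P`, the spectrum of the monoid algebra over `R` of the dual of `P`. -/
noncomputable abbrev affineChart (R : Type u) [CommRing R] {G : Type v} [AddCommGroup G]
    (P : AddSubmonoid G) : Scheme.{max u v} :=
  Spec (CommRingCat.of.{max u v} (AddMonoidAlgebra R (dualCone P)))

/-- The morphism `U_P ⟶ U_{P'}` induced by `φ` when `φ(P) ⊆ P'`. -/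
noncomputable def affineMap (R : Type u) [CommRing R] {G G' : Type v} [AddCommGroup G]
    [AddCommGroup G'] (φ : G →+ G') {P : AddSubmonoid G} {P' : AddSubmonoid G'}
    (h : P.map φ ≤ P') : affineChart R P ⟶ affineChart R P' :=
  Spec.map (CommRingCat.ofHom (AddMonoidAlgebra.mapDomainRingHom R (dualMap φ h)))

theorem affineMap_comp (R : Type u) [CommRing R] {G G' G'' : Type v} [AddCommGroup G]
    [AddCommGroup G'] [AddCommGroup G''] (φ : G →+ G') (ψ : G' →+ G'') (χ : G →+ G'')
    {P : AddSubmonoid G} {P' : AddSubmonoid G'} {P'' : AddSubmonoid G''}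
    (h : P.map φ ≤ P') (h' : P'.map ψ ≤ P'') (h'' : P.map χ ≤ P'') (e : χ = ψ.comp φ) :
    affineMap R φ h ≫ affineMap R ψ h' = affineMap R χ h'' := by
  subst e
  rw [affineMap, affineMap, ← Spec.map_comp, ← CommRingCat.ofHom_comp,
    ← AddMonoidAlgebra.mapDomainRingHom_comp]
  rfl

theorem affineMap_id (R : Type u) [CommRing R] {G : Type v} [AddCommGroup G]
    {P : AddSubmonoid G} (h : P.map (AddMonoidHom.id G) ≤ P) :
    affineMap R (AddMonoidHom.id G) h = 𝟙 _ := by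
  have : dualMap (AddMonoidHom.id G) h = AddMonoidHom.id _ := rfl
  rw [affineMap, this, AddMonoidAlgebra.mapDomainRingHom_id]
  exact Spec.map_id _

theorem map_id_le {G : Type v} [AddCommGroup G] {P Q : AddSubmonoid G} (h : P ≤ Q) :
    P.map (AddMonoidHom.id G) ≤ Q := by
  simpa using h

theorem dualMap_id_injective {G : Type v} [AddCommGroup G] {P Q : AddSubmonoid G} (h : P ≤ Q) :
    Function.Injective (dualMap (AddMonoidHom.id G) (map_id_le h)) := by
  intro σ τ e
  exact Subtype.ext (congrArg (fun ρ : dualCone P => ρ.1) e)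

theorem isLocalization_away (R : Type u) [CommRing R] {G : Type v} [AddCommGroup G]
    {P Q : AddSubmonoid G} (hQ : Q.FG) (h : P ≤ Q) (w : dualCone Q)
    (hwP : ∀ x ∈ P, w.1 x = 0) (hwQ : ∀ x ∈ Q, x ∉ P → 0 < w.1 x) :
    letI := (AddMonoidAlgebra.mapDomainRingHom R
      (dualMap (AddMonoidHom.id G) (map_id_le h))).toAlgebra
    IsLocalization.Away (AddMonoidAlgebra.single w 1 : AddMonoidAlgebra R (dualCone Q))
      (AddMonoidAlgebra R (dualCone P)) := by
  classical
  let _ := (AddMonoidAlgebra.mapDomainRingHom R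
    (dualMap (AddMonoidHom.id G) (map_id_le h))).toAlgebra
  have halg : ∀ (σ : dualCone Q) (r : R), algebraMap (AddMonoidAlgebra R (dualCone Q))
      (AddMonoidAlgebra R (dualCone P)) (AddMonoidAlgebra.single σ r) =
        AddMonoidAlgebra.single (dualMap (AddMonoidHom.id G) (map_id_le h) σ) r := by
    intro σ r
    exact AddMonoidAlgebra.mapDomain_single
  have hinj : Function.Injective (algebraMap (AddMonoidAlgebra R (dualCone Q))
      (AddMonoidAlgebra R (dualCone P))) :=
    AddMonoidAlgebra.mapDomain_injective (dualMap_id_injective h)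
  let w' : dualCone P := dualMap (AddMonoidHom.id G) (map_id_le h) w
  have hw' : w'.1 = w.1 := rfl
  let v : dualCone P := ⟨-w.1, fun x hx => by simp [hwP x hx]⟩
  have hvw : w' + v = 0 := Subtype.ext (add_neg_cancel w.1)
  obtain ⟨T, hT⟩ := hQ
  have hlift : ∀ σ : dualCone P, ∃ n : ℕ, σ.1 + n • w.1 ∈ dualCone Q := by
    intro σ
    refine ⟨∑ t ∈ T, (σ.1 t).natAbs, fun x hx => ?_⟩
    rw [← hT] at hx
    induction hx using AddSubmonoid.closure_induction with
    | mem t ht =>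
      have htQ : t ∈ Q := hT ▸ AddSubmonoid.subset_closure ht
      by_cases htP : t ∈ P
      · have := σ.2 t htP
        simpa [hwP t htP] using this
      · have h1 : (σ.1 t).natAbs ≤ ∑ t ∈ T, (σ.1 t).natAbs :=
          Finset.single_le_sum (f := fun t => (σ.1 t).natAbs) (fun _ _ => Nat.zero_le _) ht
        have h2 := hwQ t htQ htP
        generalize ∑ t ∈ T, (σ.1 t).natAbs = N at h1
        simp only [AddMonoidHom.add_apply, AddMonoidHom.nsmul_apply, nsmul_eq_mul]
        have h3 : -(N : ℤ) ≤ σ.1 t := by omega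
        have h4 : (N : ℤ) * 1 ≤ N * w.1 t := mul_le_mul_of_nonneg_left h2 (by positivity)
        linarith
    | zero => simp
    | add y z _ _ hy hz => rw [map_add]; exact add_nonneg hy hz
  refine isLocalization_iff _ _ |>.mpr ⟨?_, ?_, ?_⟩
  · rintro ⟨_, n, rfl⟩
    simp only [map_pow]
    refine IsUnit.pow n ?_
    rw [halg]
    refine IsUnit.of_mul_eq_one (AddMonoidAlgebra.single v 1) ?_
    rw [AddMonoidAlgebra.single_mul_single, one_mul, AddMonoidAlgebra.one_def]
    exact congrArg (fun z => AddMonoidAlgebra.single z (1 : R)) hvw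
  · intro z
    have : ∃ (n : ℕ) (g : AddMonoidAlgebra R (dualCone Q)),
        z * algebraMap _ (AddMonoidAlgebra R (dualCone P))
          ((AddMonoidAlgebra.single w 1 : AddMonoidAlgebra R (dualCone Q)) ^ n) =
          algebraMap _ _ g := by
      induction z using AddMonoidAlgebra.induction_linear with
      | zero => exact ⟨0, 0, by simp⟩
      | single σ r =>
        obtain ⟨n, hn⟩ := hlift σ
        refine ⟨n, AddMonoidAlgebra.single ⟨_, hn⟩ r, ?_⟩
        rw [AddMonoidAlgebra.single_pow, halg, halg, AddMonoidAlgebra.single_mul_single, one_pow,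
          mul_one, map_nsmul]
        rfl
      | add x y hx hy =>
        obtain ⟨n, f, hf⟩ := hx
        obtain ⟨m, g, hg⟩ := hy
        refine ⟨n + m, f * (AddMonoidAlgebra.single w 1) ^ m +
          g * (AddMonoidAlgebra.single w 1) ^ n, ?_⟩
        simp only [map_add, map_mul, map_pow, ← hf, ← hg, pow_add]
        ring
    obtain ⟨n, g, hg⟩ := this
    exact ⟨⟨g, ⟨_, n, rfl⟩⟩, hg⟩
  · intro x y e
    exact ⟨1, by rw [hinj e]⟩

theorem mem_range_affineMap (R : Type u) [CommRing R] {G : Type v} [AddCommGroup G]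
    {P Q : AddSubmonoid G} (hQ : Q.FG) (h : P ≤ Q) (w : dualCone Q)
    (hwP : ∀ x ∈ P, w.1 x = 0) (hwQ : ∀ x ∈ Q, x ∉ P → 0 < w.1 x) (x : affineChart R Q) :
    x ∈ Set.range (affineMap R (AddMonoidHom.id G) (map_id_le h)) ↔
      x ∈ PrimeSpectrum.basicOpen
        (AddMonoidAlgebra.single w 1 : AddMonoidAlgebra R (dualCone Q)) := by
  let _ := (AddMonoidAlgebra.mapDomainRingHom R
    (dualMap (AddMonoidHom.id G) (map_id_le h))).toAlgebra
  have := isLocalization_away R hQ h w hwP hwQ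
  exact Set.ext_iff.mp (PrimeSpectrum.localization_away_comap_range
    (AddMonoidAlgebra R (dualCone P))
    (AddMonoidAlgebra.single w 1 : AddMonoidAlgebra R (dualCone Q))) x

theorem isOpenImmersion_affineMap (R : Type u) [CommRing R] {G : Type v} [AddCommGroup G]
    {P Q : AddSubmonoid G} (hQ : Q.FG) (h : P ≤ Q) (w : dualCone Q)
    (hwP : ∀ x ∈ P, w.1 x = 0) (hwQ : ∀ x ∈ Q, x ∉ P → 0 < w.1 x) :
    IsOpenImmersion (affineMap R (AddMonoidHom.id G) (map_id_le h)) := by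
  let _ := (AddMonoidAlgebra.mapDomainRingHom R
    (dualMap (AddMonoidHom.id G) (map_id_le h))).toAlgebra
  have := isLocalization_away R hQ h w hwP hwQ
  exact IsOpenImmersion.of_isLocalization
    (AddMonoidAlgebra.single w 1 : AddMonoidAlgebra R (dualCone Q))

theorem mem_range_affineMap_inf (R : Type u) [CommRing R] {G : Type v} [AddCommGroup G]
    [Module.Free ℤ G] (Δ : Fan G) {P Q S : AddSubmonoid G} (hP : P ∈ Δ.cones) (hQ : Q ∈ Δ.cones)
    (hS : S ∈ Δ.cones) (hPS : P ≤ S) (hQS : Q ≤ S) (y : affineChart R S)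
    (hyP : y ∈ Set.range (affineMap R (AddMonoidHom.id G) (map_id_le hPS)))
    (hyQ : y ∈ Set.range (affineMap R (AddMonoidHom.id G) (map_id_le hQS))) :
    y ∈ Set.range (affineMap R (AddMonoidHom.id G)
      (map_id_le (inf_le_left.trans hPS : P ⊓ Q ≤ S))) := by
  have hk := (Δ.convex _ hS).fg
  obtain ⟨u, hu, huP, huQ⟩ := Δ.exists_expose hP hS hPS
  obtain ⟨w, hw, hwP, hwQ⟩ := Δ.exists_expose hQ hS hQS
  rw [mem_range_affineMap R hk hPS ⟨u, hu⟩ huP huQ] at hyP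
  rw [mem_range_affineMap R hk hQS ⟨w, hw⟩ hwP hwQ] at hyQ
  rw [mem_range_affineMap R hk (inf_le_left.trans hPS) (⟨u, hu⟩ + ⟨w, hw⟩)]
  · have : (AddMonoidAlgebra.single (⟨u, hu⟩ + ⟨w, hw⟩) 1 : AddMonoidAlgebra R (dualCone S)) =
        AddMonoidAlgebra.single ⟨u, hu⟩ 1 * AddMonoidAlgebra.single ⟨w, hw⟩ 1 := by
      rw [AddMonoidAlgebra.single_mul_single, mul_one]
    rw [this, PrimeSpectrum.basicOpen_mul]
    exact ⟨hyP, hyQ⟩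
  · intro z hz
    change u z + w z = 0
    rw [huP z hz.1, hwP z hz.2, add_zero]
  · intro z hz hzl
    change 0 < u z + w z
    have h1 := hu z hz
    have h2 := hw z hz
    by_cases hzP : z ∈ P
    · have := hwQ z hz fun hzQ => hzl ⟨hzP, hzQ⟩
      linarith
    · have := huQ z hz hzP
      linarith

theorem isOpenImmersion_affineMap_of_mem (R : Type u) [CommRing R] {G : Type v} [AddCommGroup G]
    [Module.Free ℤ G] (Δ : Fan G) {P Q : AddSubmonoid G} (hP : P ∈ Δ.cones) (hQ : Q ∈ Δ.cones)
    (h : P ≤ Q) : IsOpenImmersion (affineMap R (AddMonoidHom.id G) (map_id_le h)) := by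
  obtain ⟨w, hw, hwP, hwQ⟩ := Δ.exists_expose hP hQ h
  exact isOpenImmersion_affineMap R (Δ.convex _ hQ).fg h ⟨w, hw⟩ hwP hwQ

theorem Fan.exists_affineMap_eq (R : Type u) [CommRing R] {G : Type v} [AddCommGroup G]
    [Module.Free ℤ G] (Δ : Fan G) {P Q S : AddSubmonoid G} (hP : P ∈ Δ.cones) (hQ : Q ∈ Δ.cones)
    (hS : S ∈ Δ.cones) (hPS : P ≤ S) (hQS : Q ≤ S) (a : affineChart R P) (b : affineChart R Q)
    (e : affineMap R (AddMonoidHom.id G) (map_id_le hPS) a =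
      affineMap R (AddMonoidHom.id G) (map_id_le hQS) b) :
    ∃ x : affineChart R (P ⊓ Q),
      affineMap R (AddMonoidHom.id G) (map_id_le inf_le_left) x = a ∧
      affineMap R (AddMonoidHom.id G) (map_id_le inf_le_right) x = b := by
  have := isOpenImmersion_affineMap_of_mem R Δ hP hS hPS
  have := isOpenImmersion_affineMap_of_mem R Δ hQ hS hQS
  obtain ⟨x, hx⟩ := mem_range_affineMap_inf R Δ hP hQ hS hPS hQS _ ⟨a, rfl⟩ ⟨b, e.symm⟩
  refine ⟨x, ?_, ?_⟩
  · apply (affineMap R (AddMonoidHom.id G) (map_id_le hPS)).isOpenEmbedding.injective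
    rw [← hx, ← Scheme.Hom.comp_apply, affineMap_comp R _ _ (AddMonoidHom.id G)
      _ _ (map_id_le (inf_le_left.trans hPS)) rfl]
  · apply (affineMap R (AddMonoidHom.id G) (map_id_le hQS)).isOpenEmbedding.injective
    rw [← e, ← hx, ← Scheme.Hom.comp_apply, affineMap_comp R _ _ (AddMonoidHom.id G)
      _ _ (map_id_le (inf_le_left.trans hPS)) rfl]

/-! ### The toric scheme of a fan -/

/-- The diagram of affine charts of a fan: the cones are ordered by inclusion, and `P ⊆ Q` is sent
to the morphism `U_P ⟶ U_Q` given by the inclusion of the dual of `Q` into the dual of `P`. -/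
noncomputable def Fan.diagram (R : Type u) [CommRing R] {G : Type v} [AddCommGroup G]
    (Δ : Fan G) : Δ.cones ⥤ Scheme.{max u v} where
  obj P := affineChart R P.1
  map {P Q} f := affineMap R (AddMonoidHom.id G) (P := P.1) (P' := Q.1) (map_id_le (leOfHom f))
  map_id P := affineMap_id R (map_id_le (le_refl P.1))
  map_comp {P Q S} f g := by
    have hf : P.1 ≤ Q.1 := leOfHom f
    have hg : Q.1 ≤ S.1 := leOfHom g
    exact (affineMap_comp R (AddMonoidHom.id G) (AddMonoidHom.id G) (AddMonoidHom.id G)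
      (map_id_le hf) (map_id_le hg) (map_id_le (hf.trans hg)) rfl).symm

instance Fan.isOpenImmersion_diagram_map (R : Type u) [CommRing R] {G : Type v} [AddCommGroup G]
    [Module.Free ℤ G] (Δ : Fan G) {P Q : Δ.cones} (f : P ⟶ Q) :
    IsOpenImmersion ((Δ.diagram R).map f) := by
  exact isOpenImmersion_affineMap_of_mem R Δ P.2 Q.2 (leOfHom f)

instance Fan.isLocallyDirected_diagram (R : Type u) [CommRing R] {G : Type v} [AddCommGroup G]
    [Module.Free ℤ G] (Δ : Fan G) : (Δ.diagram R ⋙ Scheme.forget).IsLocallyDirected := by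
  constructor
  intro i j k fi fj xi xj e
  obtain ⟨x, hx, hx'⟩ := Δ.exists_affineMap_eq R i.2 j.2 k.2 (leOfHom fi) (leOfHom fj) xi xj e
  have hli : (⟨i.1 ⊓ j.1, Δ.inf_mem i.2 j.2⟩ : Δ.cones) ≤ i :=
    show i.1 ⊓ j.1 ≤ i.1 from inf_le_left
  have hlj : (⟨i.1 ⊓ j.1, Δ.inf_mem i.2 j.2⟩ : Δ.cones) ≤ j :=
    show i.1 ⊓ j.1 ≤ j.1 from inf_le_right
  exact ⟨⟨i.1 ⊓ j.1, Δ.inf_mem i.2 j.2⟩, homOfLE hli, homOfLE hlj, x, hx, hx'⟩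

/-- The toric scheme of the fan `Δ` over `R`: the gluing of the affine charts `U_P`, `P ∈ Δ`, along
the open immersions `U_P ⟵ U_{P ∩ Q} ⟶ U_Q`, constructed as the colimit of the (locally directed)
diagram of the charts and the open immersions between them. -/
noncomputable def Fan.toricScheme (R : Type u) [CommRing R] {G : Type v} [AddCommGroup G]
    [Module.Free ℤ G] (Δ : Fan G) : Scheme.{max u v} :=
  colimit (Δ.diagram R)

/-- The open immersion of `U_P` into the toric scheme. -/
noncomputable def Fan.chartι (R : Type u) [CommRing R] {G : Type v} [AddCommGroup G]
    [Module.Free ℤ G] (Δ : Fan G) (P : Δ.cones) : affineChart R P.1 ⟶ Δ.toricScheme R :=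
  colimit.ι (Δ.diagram R) P

instance Fan.isOpenImmersion_chartι (R : Type u) [CommRing R] {G : Type v} [AddCommGroup G]
    [Module.Free ℤ G] (Δ : Fan G) (P : Δ.cones) : IsOpenImmersion (Δ.chartι R P) :=
  inferInstanceAs (IsOpenImmersion (colimit.ι (Δ.diagram R) P))

/-- `U_P` as an open subset of the toric scheme. -/
noncomputable def Fan.chart (R : Type u) [CommRing R] {G : Type v} [AddCommGroup G]
    [Module.Free ℤ G] (Δ : Fan G) (P : Δ.cones) : (Δ.toricScheme R).Opens :=
  (Δ.chartι R P).opensRange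

theorem Fan.affineMap_chartι (R : Type u) [CommRing R] {G : Type v} [AddCommGroup G]
    [Module.Free ℤ G] (Δ : Fan G) {P Q : Δ.cones} (h : P.1.map (AddMonoidHom.id G) ≤ Q.1) :
    affineMap R (AddMonoidHom.id G) h ≫ Δ.chartι R Q = Δ.chartι R P :=
  colimit.w (Δ.diagram R) (homOfLE (show P ≤ Q by simpa using h))

/-! ### Morphisms of toric schemes -/

theorem FanHom.affineMap_chartι_eq (R : Type u) [CommRing R] {G G' : Type v} [AddCommGroup G]
    [AddCommGroup G'] [Module.Free ℤ G'] {Δ : Fan G} {Δ' : Fan G'}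
    (φ : FanHom Δ Δ') {P : AddSubmonoid G} {P' P'' : Δ'.cones}
    (h' : P.map φ.toAddMonoidHom ≤ P'.1) (h'' : P.map φ.toAddMonoidHom ≤ P''.1) :
    affineMap R φ.toAddMonoidHom h' ≫ Δ'.chartι R P' =
      affineMap R φ.toAddMonoidHom h'' ≫ Δ'.chartι R P'' := by
  let I : Δ'.cones := ⟨P'.1 ⊓ P''.1, Δ'.inf_mem P'.2 P''.2⟩
  have h : P.map φ.toAddMonoidHom ≤ I.1 := le_inf h' h''
  have key : ∀ (Q : Δ'.cones) (hQ : P.map φ.toAddMonoidHom ≤ Q.1), I.1 ≤ Q.1 →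
      affineMap R φ.toAddMonoidHom hQ ≫ Δ'.chartι R Q =
        affineMap R φ.toAddMonoidHom h ≫ Δ'.chartι R I := by
    intro Q hQ hIQ
    rw [← Δ'.affineMap_chartι R (map_id_le hIQ), ← Category.assoc,
      affineMap_comp R _ _ φ.toAddMonoidHom _ _ hQ rfl]
  rw [key P' h' inf_le_left, key P'' h'' inf_le_right]

/-- The morphism `U_P ⟶ U_{P'} ⟶ X'` into the toric scheme `X'` of the target given by
`σ ↦ σ ∘ φ`, for some cone `P'` of the target with `φ(P) ⊆ P'`; by the theorem above it does not
depend on the choice of `P'`. -/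
noncomputable def FanHom.chartMap (R : Type u) [CommRing R] {G G' : Type v} [AddCommGroup G]
    [AddCommGroup G'] [Module.Free ℤ G'] {Δ : Fan G} {Δ' : Fan G'}
    (φ : FanHom Δ Δ') (P : Δ.cones) : affineChart R P.1 ⟶ Δ'.toricScheme R :=
  affineMap R φ.toAddMonoidHom (φ.exists_map_le P.1 P.2).choose_spec.2 ≫
    Δ'.chartι R ⟨_, (φ.exists_map_le P.1 P.2).choose_spec.1⟩

theorem FanHom.chartMap_eq (R : Type u) [CommRing R] {G G' : Type v} [AddCommGroup G]
    [AddCommGroup G'] [Module.Free ℤ G'] {Δ : Fan G} {Δ' : Fan G'}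
    (φ : FanHom Δ Δ') (P : Δ.cones) (P' : Δ'.cones) (h : P.1.map φ.toAddMonoidHom ≤ P'.1) :
    φ.chartMap R P = affineMap R φ.toAddMonoidHom h ≫ Δ'.chartι R P' :=
  φ.affineMap_chartι_eq R (P' := ⟨_, (φ.exists_map_le P.1 P.2).choose_spec.1⟩) (P'' := P')
    (φ.exists_map_le P.1 P.2).choose_spec.2 h

theorem FanHom.affineMap_chartMap (R : Type u) [CommRing R] {G G' : Type v} [AddCommGroup G]
    [AddCommGroup G'] [Module.Free ℤ G'] {Δ : Fan G} {Δ' : Fan G'}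
    (φ : FanHom Δ Δ') {P Q : Δ.cones} (h : P.1.map (AddMonoidHom.id G) ≤ Q.1) :
    affineMap R (AddMonoidHom.id G) h ≫ φ.chartMap R Q = φ.chartMap R P := by
  obtain ⟨Q', hQ', hQQ'⟩ := φ.exists_map_le Q.1 Q.2
  have hPQ : P.1 ≤ Q.1 := by simpa using h
  have hPQ' : P.1.map φ.toAddMonoidHom ≤ Q' := (AddSubmonoid.monotone_map hPQ).trans hQQ'
  rw [φ.chartMap_eq R Q ⟨Q', hQ'⟩ hQQ', φ.chartMap_eq R P ⟨Q', hQ'⟩ hPQ', ← Category.assoc,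
    affineMap_comp R _ _ φ.toAddMonoidHom _ _ hPQ' rfl]

/-- The compatible family of morphisms `U_P ⟶ X'`, `P ∈ Δ`, into the toric scheme `X'` of `Δ'`. -/
noncomputable def FanHom.cocone (R : Type u) [CommRing R] {G G' : Type v} [AddCommGroup G]
    [AddCommGroup G'] [Module.Free ℤ G'] {Δ : Fan G} {Δ' : Fan G'}
    (φ : FanHom Δ Δ') : Cocone (Δ.diagram R) where
  pt := Δ'.toricScheme R
  ι :=
    { app := fun P => φ.chartMap R P
      naturality := fun _ _ f =>
        (φ.affineMap_chartMap R (map_id_le (leOfHom f))).trans (Category.comp_id _).symm }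

/-- The morphism `φ_*` of toric schemes over `R` induced by a homomorphism of fans `φ`, obtained by
gluing the morphisms `U_P ⟶ U_{P'}` given by `σ ↦ σ ∘ φ`, where `φ(P) ⊆ P'`. -/
noncomputable def FanHom.toricMap (R : Type u) [CommRing R] {G G' : Type v} [AddCommGroup G]
    [AddCommGroup G'] [Module.Free ℤ G] [Module.Free ℤ G'] {Δ : Fan G} {Δ' : Fan G'}
    (φ : FanHom Δ Δ') : Δ.toricScheme R ⟶ Δ'.toricScheme R :=
  colimit.desc (Δ.diagram R) (φ.cocone R)

theorem FanHom.chartι_toricMap (R : Type u) [CommRing R] {G G' : Type v} [AddCommGroup G]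
    [AddCommGroup G'] [Module.Free ℤ G] [Module.Free ℤ G'] {Δ : Fan G} {Δ' : Fan G'}
    (φ : FanHom Δ Δ') (P : Δ.cones) (P' : Δ'.cones) (h : P.1.map φ.toAddMonoidHom ≤ P'.1) :
    Δ.chartι R P ≫ φ.toricMap R = affineMap R φ.toAddMonoidHom h ≫ Δ'.chartι R P' := by
  rw [← φ.chartMap_eq R P P' h]
  exact colimit.ι_desc (φ.cocone R) P

end ToricFan

/-! The inclusion `⊇` holds because on `U_P` with `φ(P) ⊆ P'` the morphism `φ_*` factors through
`U_{P'}`.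

For `⊆`, let `x ∈ U_Q` have image in `U_{P'}`, and choose `Q'` in the target fan with `φ(Q) ⊆ Q'`.
The image lies in `U_{Q'}` and `U_{P'}`, hence in `U_S` for some cone `S ⊆ Q' ∩ P'` of the fan. By
`Fan.exists_expose` some `w` in the dual of `Q'` vanishes on `S` and is positive on the rest of
`Q'`, so inside `U_{Q'}` the open set `U_S` is the locus where the monomial of `w` is invertible
(`mem_range_affineMap`). Its preimage in `U_Q` is the locus where the monomial of `w ∘ φ` is
invertible (`affineMap_mem_basicOpen_iff`). As `w ∘ φ ≥ 0` on `Q`, this locus is `U_P` for the face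
`P = {y ∈ Q : w(φ(y)) = 0}` (`mem_range_affineMap_zeroFace`), which belongs to the source fan
(`Fan.zeroFace_mem`). So `x ∈ U_P`, and `φ(P) ⊆ Q' ∩ {w = 0} = S ⊆ P'`. -/

namespace ToricFan

/-! ### Faces cut out by nonnegative functionals. -/

/-- The part of `Q` on which a nonnegative functional `w` vanishes. -/
def zeroFace {G : Type v} [AddCommGroup G] (Q : AddSubmonoid G) (w : G →+ ℤ) : AddSubmonoid G :=
  Q ⊓ AddMonoidHom.mker w

theorem zeroFace_le {G : Type v} [AddCommGroup G] (Q : AddSubmonoid G) (w : G →+ ℤ) :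
    zeroFace Q w ≤ Q :=
  inf_le_left

theorem isPrimeIdeal_setOf_pos {G : Type v} [AddCommGroup G] {Q : AddSubmonoid G} {w : G →+ ℤ}
    (hw : w ∈ dualCone Q) : IsPrimeIdeal {x : Q | 0 < w x} where
  add_mem x y hy := by
    have hx : 0 ≤ w x := hw x x.2
    change 0 < w y at hy
    change 0 < w (x + y)
    rw [map_add]
    omega
  zero_notMem := by simp
  add_notMem x y hx hy := by
    change ¬ 0 < w x at hx
    change ¬ 0 < w y at hy
    change ¬ 0 < w (x + y)
    rw [map_add]
    omega

/-- Nonnegativity of `w` on `Q` makes "not positive" the same as "zero" there. -/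
theorem faceOf_setOf_pos {G : Type v} [AddCommGroup G] {Q : AddSubmonoid G} {w : G →+ ℤ}
    (hw : w ∈ dualCone Q) : faceOf Q (isPrimeIdeal_setOf_pos hw) = zeroFace Q w := by
  ext x
  constructor
  · rintro ⟨y, hy, rfl⟩
    exact ⟨y.2, le_antisymm (not_lt.mp hy) (hw y y.2)⟩
  · rintro ⟨hxQ, hx⟩
    exact ⟨⟨x, hxQ⟩, not_lt.mpr (le_of_eq hx), rfl⟩

/-- Closure of the fan under faces enters here; it supplies the source cone that the theorem needs.
-/
theorem Fan.zeroFace_mem {G : Type v} [AddCommGroup G] (Δ : Fan G) {Q : AddSubmonoid G}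
    (hQ : Q ∈ Δ.cones) {w : G →+ ℤ} (hw : w ∈ dualCone Q) : zeroFace Q w ∈ Δ.cones :=
  faceOf_setOf_pos hw ▸ Δ.face_mem Q hQ _ (isPrimeIdeal_setOf_pos hw)

/-! ### Basic opens of monomials in the affine charts. -/

/-- Complements `Fan.exists_expose`: there a face yields a functional, here a functional yields the
face. Off its zero set in `Q`, a nonnegative `w` is positive, so it exposes `zeroFace Q w`. -/
theorem mem_range_affineMap_zeroFace (R : Type u) [CommRing R] {G : Type v} [AddCommGroup G]
    {Q : AddSubmonoid G} (hQ : Q.FG) (w : dualCone Q) (x : affineChart R Q) :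
    x ∈ Set.range (affineMap R (AddMonoidHom.id G)
        (map_id_le (zeroFace_le Q w.1))) ↔
      x ∈ PrimeSpectrum.basicOpen
        (AddMonoidAlgebra.single w 1 : AddMonoidAlgebra R (dualCone Q)) :=
  mem_range_affineMap R hQ (zeroFace_le Q w.1) w (fun _ hx => hx.2)
    (fun x hx hx' => lt_of_le_of_ne (w.2 x hx) fun e => hx' ⟨hx, e.symm⟩) x

/-- The ring map behind `affineMap` sends the monomial of `w` to that of `w ∘ φ`, and pulling back a
basic open set means applying the ring map to its function. -/
theorem affineMap_mem_basicOpen_iff (R : Type u) [CommRing R] {G G' : Type v} [AddCommGroup G]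
    [AddCommGroup G'] (φ : G →+ G') {P : AddSubmonoid G} {P' : AddSubmonoid G'}
    (h : P.map φ ≤ P') (w : dualCone P') (x : affineChart R P) :
    affineMap R φ h x ∈ PrimeSpectrum.basicOpen
        (AddMonoidAlgebra.single w 1 : AddMonoidAlgebra R (dualCone P')) ↔
      x ∈ PrimeSpectrum.basicOpen
        (AddMonoidAlgebra.single (dualMap φ h w) 1 : AddMonoidAlgebra R (dualCone P)) := by
  have e : AddMonoidAlgebra.mapDomainRingHom R (dualMap φ h) (AddMonoidAlgebra.single w 1) =
      AddMonoidAlgebra.single (dualMap φ h w) 1 := AddMonoidAlgebra.mapDomain_single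
  rw [← e]
  rfl

/-! ### Points of the glued scheme. -/

theorem Fan.exists_chartι_eq (R : Type u) [CommRing R] {G : Type v} [AddCommGroup G]
    [Module.Free ℤ G] (Δ : Fan G) (x : Δ.toricScheme R) :
    ∃ (P : Δ.cones) (a : affineChart R P.1), Δ.chartι R P a = x :=
  Scheme.IsLocallyDirected.ι_jointly_surjective (Δ.diagram R) x

/-- In a locally directed gluing, points of two charts are identified only through a common smaller
chart. It is enough that `S` lies in both cones; it need not be `P ∩ Q`. -/
theorem Fan.exists_of_chartι_eq (R : Type u) [CommRing R] {G : Type v} [AddCommGroup G]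
    [Module.Free ℤ G] (Δ : Fan G) {P Q : Δ.cones} {a : affineChart R P.1} {b : affineChart R Q.1}
    (e : Δ.chartι R P a = Δ.chartι R Q b) :
    ∃ (S : Δ.cones) (hP : S.1 ≤ P.1) (_ : S.1 ≤ Q.1) (c : affineChart R S.1),
      affineMap R (AddMonoidHom.id G) (map_id_le hP) c = a := by
  obtain ⟨S, f, g, c, hc, -⟩ := (Scheme.IsLocallyDirected.ι_eq_ι_iff (Δ.diagram R)).mp e
  exact ⟨S, leOfHom f, leOfHom g, c, hc⟩

/-! ### The two inclusions. -/

theorem FanHom.chart_le_preimage (R : Type u) [CommRing R] {G G' : Type v} [AddCommGroup G]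
    [AddCommGroup G'] [Module.Free ℤ G] [Module.Free ℤ G'] {Δ : Fan G} {Δ' : Fan G'}
    (φ : FanHom Δ Δ') {P : Δ.cones} {P' : Δ'.cones} (h : P.1.map φ.toAddMonoidHom ≤ P'.1) :
    Δ.chart R P ≤ (φ.toricMap R) ⁻¹ᵁ (Δ'.chart R P') := by
  rintro _ ⟨a, rfl⟩
  refine ⟨affineMap R φ.toAddMonoidHom h a, ?_⟩
  rw [← Scheme.Hom.comp_apply, ← φ.chartι_toricMap R P P' h]
  exact Scheme.Hom.comp_apply _ _ _

theorem FanHom.exists_mem_chart (R : Type u) [CommRing R] {G G' : Type v} [AddCommGroup G]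
    [AddCommGroup G'] [Module.Free ℤ G] [Module.Free ℤ G'] {Δ : Fan G} {Δ' : Fan G'}
    (φ : FanHom Δ Δ') {P' : Δ'.cones} {x : Δ.toricScheme R}
    (hx : φ.toricMap R x ∈ Δ'.chart R P') :
    ∃ P : Δ.cones, P.1.map φ.toAddMonoidHom ≤ P'.1 ∧ x ∈ Δ.chart R P := by
  obtain ⟨Q, a, rfl⟩ := Δ.exists_chartι_eq R x
  -- `Q'` need not be related to `P'`; it provides a chart in which `φ_*` is given by a monomial
  -- map.
  obtain ⟨Q', hQ', hQQ'⟩ := φ.exists_map_le Q.1 Q.2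
  obtain ⟨b, hb⟩ := hx
  have hab : Δ'.chartι R ⟨Q', hQ'⟩ (affineMap R φ.toAddMonoidHom hQQ' a) = Δ'.chartι R P' b := by
    rw [hb, ← Scheme.Hom.comp_apply, ← φ.chartι_toricMap R Q ⟨Q', hQ'⟩ hQQ']
    exact Scheme.Hom.comp_apply _ _ _
  obtain ⟨S, hSQ, hSP, c, hc⟩ := Δ'.exists_of_chartι_eq R hab
  obtain ⟨w, hw, hwS, hwQ⟩ := Δ'.exists_expose S.2 hQ' hSQ
  -- The image of `a` in `U_{Q'}` comes from `c` in `U_S`, so the monomial of `w` does not vanish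
  -- there.
  have hmem := (mem_range_affineMap R (Δ'.convex _ hQ').fg hSQ ⟨w, hw⟩ hwS hwQ _).mp ⟨c, hc⟩
  -- Pulled back to `U_Q`, the condition says that `a` lies in the chart of the face where `w ∘ φ`
  -- vanishes.
  rw [affineMap_mem_basicOpen_iff,
    ← mem_range_affineMap_zeroFace R (Δ.convex _ Q.2).fg] at hmem
  obtain ⟨d, rfl⟩ := hmem
  let P : Δ.cones := ⟨_, Δ.zeroFace_mem Q.2 (dualMap φ.toAddMonoidHom hQQ' ⟨w, hw⟩).2⟩
  refine ⟨P, ?_, d, ?_⟩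
  · rintro _ ⟨y, ⟨hyQ, hy⟩, rfl⟩
    -- If `φ(y) ∉ P'`, then `φ(y) ∈ Q'` lies outside `S`, so `w(φ(y)) > 0`, against `y` being in the
    -- zero face.
    by_contra hyP
    exact (hwQ _ (hQQ' ⟨y, hyQ, rfl⟩) fun hyS => hyP (hSP hyS)).ne' hy
  -- The gluing identifies `d` in `U_P` with its image in `U_Q`.
  · have e := Δ.affineMap_chartι R (P := P) (Q := Q) (map_id_le (zeroFace_le Q.1 _))
    rw [← e]
    exact Scheme.Hom.comp_apply _ _ _

end ToricFan

theorem mainTheorem7 (R : Type u) [CommRing R] {G G' : Type v}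
    [AddCommGroup G] [Module.Free ℤ G] [Module.Finite ℤ G]
    [AddCommGroup G'] [Module.Free ℤ G'] [Module.Finite ℤ G']
    (Δ : ToricFan.Fan G) (Δ' : ToricFan.Fan G') (φ : ToricFan.FanHom Δ Δ') (P' : Δ'.cones) :
    (φ.toricMap R) ⁻¹ᵁ (Δ'.chart R P') =
      ⨆ (P : Δ.cones) (_ : P.1.map φ.toAddMonoidHom ≤ P'.1), Δ.chart R P := by
  refine le_antisymm (fun x hx => ?_) (iSup₂_le fun P h => φ.chart_le_preimage R h)
  obtain ⟨P, h, hxP⟩ := φ.exists_mem_chart R hx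
  exact le_iSup₂ (f := fun (P : Δ.cones) (_ : P.1.map φ.toAddMonoidHom ≤ P'.1) => Δ.chart R P)
    P h hxP
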